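/- Let $(X,\mathcal A,\mu)$ and $(Y,\mathcal B,\nu)$ be $\sigma$-finite measure spaces. Let $X^*$ be the space of all measures on $(X,\mathcal A)$, with the $\sigma$-algebra $\mathcal A^*$ generated by the maps $N(A):\xi\mapsto\xi(A)$, $A\in\mathcal A$, and let $\mu^*$ be the Poisson measure over $(X,\mathcal A,\mu)$, i.e. the probability measure on $(X^*,\mathcal A^*)$ such that, for all disjoint sets $A_1,\dots,A_k\in\mathcal A$ of finite $\mu$-measure, $N(A_1),\dots,N(A_k)$ are independent Poisson variables of parameters $\mu(A_1),\dots,\mu(A_k)$. Define $(Y^*,\mathcal B^*,\nu^*)$ in the same way from $(Y,\mathcal B,\nu)$. All $L^2$ spaces are complex. For $g\in L^2(\mu)$ let $$M_X(g)=\lim_{n\to\infty}\Big(\int_X g_n\,dN-\int_X g_n\,d\mu\Big)\quad\text{in }L^2(\mu^*),$$ where $g_n\in L^1(\mu)\cap L^2(\mu)$ and $g_n\to g$ in $L^2(\mu)$, be the centered stochastic integral of $g$, and let $\mathfrak C_X=\{M_X(g):g\in L^2(\mu)\}\subset L^2(\mu^*)$ be the first chaos; $M_Y$ and $\mathfrak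 C_Y$ are defined in the same way. A bounded linear operator between $L^2$ spaces is called nonnegative if it maps nonnegative functions to nonnegative functions. (a) Let $\Psi:L^2(\mu^*)\to L^2(\nu^*)$ be a Markov operator, i.e. a nonnegative bounded linear operator with $\Psi 1=1$ and $\Psi^*1=1$, and suppose that $\Psi(\mathfrak C_X)\subset\mathfrak C_Y$. Then there is exactly one bounded linear operator $\Theta:L^2(\mu)\to L^2(\nu)$ such that $\Psi(M_X(g))=M_Y(\Theta g)$ for all $g\in L^2(\mu)$, and $\Theta$ is a sub-Markov operator: it is nonnegative, $\Theta 1\le 1$ and $\Theta^*1\le 1$. (Here $\Phi 1\le 1$ means that $\Phi f\le 1$ almost everywhere for every $f$ in the $L^2$ space on which $\Phi$ acts with $0\le f\le 1$ almost everywhere.) (b) Every nonnegative element of $\mathbb C\oplus\mathfrak C_Y$ is almost surely equal to $\int_Y f\,dN+c$ for some real $f\in L^1(\nu)\cap L^2(\nu)$ with $f\ge 0$ $\nu$-almost everywhere, and some real $c\ge 0$ (with $f$ integrable with respect to $N$ almost surely). -/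

import Mathlib

open MeasureTheory ProbabilityTheory Filter Topology
open scoped ENNReal NNReal ComplexOrder

/-- `P` is the Poisson measure over the base `(X, μ)`: a law on the space `Measure X` of measures
on `X`, which carries the `σ`-algebra generated by the evaluations `N(A) : ξ ↦ ξ A`, such that
`N(A)` is a Poisson variable of parameter `μ A` when `μ A < ∞`, and such that
`N(A₁), …, N(Aₖ)` are independent when `A₁, …, Aₖ` are disjoint sets of finite measure. -/
structure IsPoissonMeasure {X : Type*} [MeasurableSpace X]
    (μ : Measure X) (P : Measure (Measure X)) : Prop where
  map_eval : ∀ A : Set X, MeasurableSet A → μ A ≠ ∞ →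
    P.map (fun ξ : Measure X => ξ A)
      = (poissonMeasure (μ A).toNNReal).map (fun k : ℕ => (k : ℝ≥0∞))
  indep : ∀ (k : ℕ) (A : Fin k → Set X), (∀ i, MeasurableSet (A i)) → (∀ i, μ (A i) ≠ ∞) →
    (∀ i j, i ≠ j → Disjoint (A i) (A j)) →
    iIndepFun (fun (i : Fin k) (ξ : Measure X) => ξ (A i)) P

/-- `F` is the centered stochastic integral `M(g)` of `g ∈ L²(μ)`: the limit in `L²(P)` of
`∫ gₙ dN - ∫ gₙ dμ`, for some `gₙ ∈ L¹(μ) ∩ L²(μ)` with `gₙ → g` in `L²(μ)`. -/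
def IsCenteredIntegral {X : Type*} [MeasurableSpace X]
    (μ : Measure X) (P : Measure (Measure X)) (g : Lp ℂ 2 μ) (F : Lp ℂ 2 P) : Prop :=
  ∃ (u : ℕ → Lp ℂ 2 μ) (V : ℕ → Lp ℂ 2 P),
    (∀ n, Integrable (u n) μ) ∧
    (∀ n, ∀ᵐ ξ ∂P, V n ξ = (∫ x, u n x ∂ξ) - (∫ x, u n x ∂μ)) ∧
    Tendsto u atTop (𝓝 g) ∧ Tendsto V atTop (𝓝 F)

/-- The first chaos of `L²(P)`: all centered stochastic integrals of functions of `L²(μ)`. -/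
def firstChaos {X : Type*} [MeasurableSpace X]
    (μ : Measure X) (P : Measure (Measure X)) : Set (Lp ℂ 2 P) :=
  {F | ∃ g : Lp ℂ 2 μ, IsCenteredIntegral μ P g F}

/-- A nonnegative operator between `L²` spaces: it maps (real) nonnegative functions to
(real) nonnegative functions; `0 ≤ z` for complex `z` means that `z` is real and nonnegative. -/
def IsNonnegOperator {X Y : Type*} [MeasurableSpace X] [MeasurableSpace Y]
    {μ : Measure X} {ν : Measure Y} (Φ : Lp ℂ 2 μ →L[ℂ] Lp ℂ 2 ν) : Prop :=
  ∀ f : Lp ℂ 2 μ, (∀ᵐ x ∂μ, 0 ≤ f x) → ∀ᵐ y ∂ν, 0 ≤ Φ f y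

/-- A Markov operator between the `L²` spaces of two probability measures: it is nonnegative,
and it and its adjoint map the constant `1` to the constant `1`. -/
structure IsMarkovOperator {X Y : Type*} [MeasurableSpace X] [MeasurableSpace Y]
    {P : Measure X} {Q : Measure Y} [IsProbabilityMeasure P] [IsProbabilityMeasure Q]
    (Ψ : Lp ℂ 2 P →L[ℂ] Lp ℂ 2 Q) : Prop where
  nonneg : IsNonnegOperator Ψ
  map_one : Ψ (Lp.const 2 P (1 : ℂ)) = Lp.const 2 Q (1 : ℂ)
  adjoint_map_one :
    ContinuousLinearMap.adjoint Ψ (Lp.const 2 Q (1 : ℂ)) = Lp.const 2 P (1 : ℂ)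

/-- `Φ 1 ≤ 1`. The constant `1` need not be in `L²(μ)`, so this means `Φ f ≤ 1` for all `f` in
`L²(μ)` with `0 ≤ f ≤ 1`. -/
def MapsOneLeOne {X Y : Type*} [MeasurableSpace X] [MeasurableSpace Y]
    {μ : Measure X} {ν : Measure Y} (Φ : Lp ℂ 2 μ →L[ℂ] Lp ℂ 2 ν) : Prop :=
  ∀ f : Lp ℂ 2 μ, (∀ᵐ x ∂μ, 0 ≤ f x ∧ f x ≤ 1) → ∀ᵐ y ∂ν, Φ f y ≤ 1

/-- A sub-Markov operator: a nonnegative operator `Φ` with `Φ 1 ≤ 1` and `Φ* 1 ≤ 1`. -/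
structure IsSubMarkovOperator {X Y : Type*} [MeasurableSpace X] [MeasurableSpace Y]
    {μ : Measure X} {ν : Measure Y} (Φ : Lp ℂ 2 μ →L[ℂ] Lp ℂ 2 ν) : Prop where
  nonneg : IsNonnegOperator Φ
  map_one_le : MapsOneLeOne Φ
  adjoint_map_one_le : MapsOneLeOne (ContinuousLinearMap.adjoint Φ)

/-- `Ψ`, restricted to the first chaos, induces `Θ : L²(μ) → L²(ν)` through the identification
`g ↔ M(g)` of `L²(μ)` and `L²(ν)` with the first chaoses: `Ψ (M(g)) = M(Θ g)` for all `g`. -/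
def InducesOnFirstChaos {X Y : Type*} [MeasurableSpace X] [MeasurableSpace Y]
    (μ : Measure X) (ν : Measure Y) {P : Measure (Measure X)} {Q : Measure (Measure Y)}
    (Ψ : Lp ℂ 2 P →L[ℂ] Lp ℂ 2 Q) (Θ : Lp ℂ 2 μ →L[ℂ] Lp ℂ 2 ν) : Prop :=
  ∀ g : Lp ℂ 2 μ, ∃ F : Lp ℂ 2 P, IsCenteredIntegral μ P g F ∧ IsCenteredIntegral ν Q (Θ g) (Ψ F)

/-!
Identifying `L²(μ)` with the first chaos through the isometry `M`, everything rests on one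
consequence of positivity. For a set `A` of finite measure and `x ≥ 0`, weighting the Poisson law by
`x ^ N(A)` multiplies the intensity by `x` on `A`, so that
`E[M(g) x ^ N(A)] = (x - 1) e^{(x - 1) μ(A)} ∫_A g dμ` (`inner_rpow_centeredIntegral`). If
`M(g) + b ≥ 0`, this gives `(x - 1) ∫_A g dμ + b ≥ 0` for all `x ≥ 0` and all `A`. As `x → ∞` one
finds `∫_A g dμ ≥ 0`, and `x = 0` gives `∫_A g dμ ≤ b`; hence `g` is nonnegative and integrable with
`∫ g dμ ≤ b` (`nonneg_and_integrable_of_ae_nonneg`). Since `M(g) = ∫ g dN - ∫ g dμ` for integrable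
`g`, nonnegative elements of `ℂ ⊕ 𝔠` have the form `∫ g dN + c` with `g ≥ 0` and
`c = b - ∫ g dμ ≥ 0`.

A Markov operator `Ψ` that preserves the first chaoses induces `Θ = M_Y* Ψ M_X`. For `A` of finite
measure, `Ψ(N(A)) = M_Y(Θ 1_A) + μ(A)` is nonnegative, so that `Θ 1_A ≥ 0` and
`∫ Θ 1_A dν ≤ μ(A)`, and `Ψ(N(A)) ≥ ∫ Θ 1_A dN`. If `Θ 1_A ≥ r > 1` on a set `B` of finite measure,
then `Ψ(N(A)) ≥ r N(B)`, and Jensen's inequality for `Ψ` gives `E[e^{s r N(B)}] ≤ E[e^{s N(A)}]`,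
that is `(e^{s r} - 1) ν(B) ≤ (e^s - 1) μ(A)`, for all `s ≥ 0`; letting `s → ∞` yields `ν(B) = 0`.
So `Θ 1_A ≤ 1` (`ae_apply_indicator_le_one`). Therefore `⟨1_B, Θ 1_A⟩` lies between `0` and
`min (μ(A)) (ν(B))` for all `A` and `B`, and these bounds say that `Θ` is sub-Markov
(`isNonnegOperator_and_mapsOneLeOne`, applied to `Θ` and to its adjoint).

The isometry `M` (`centeredIntegral`) is obtained from the covariances
`cov(N(A), N(B)) = μ(A ∩ B)`, which make the Gram matrices of the families `1_A` and `N(A) - μ(A)`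
equal.
-/

/-! ### Moments of the Poisson law -/

/-- The identity `E[N f(N)] = r E[f(N + 1)]` for a Poisson variable `N` of parameter `r`. -/
lemma hasSum_poisson_shift {r : ℝ≥0} {f : ℕ → ℝ} {S : ℝ}
    (h : HasSum (fun n : ℕ => Real.exp (-r) * r ^ n / n.factorial * f (n + 1)) S) :
    HasSum (fun n : ℕ => Real.exp (-r) * r ^ n / n.factorial * (n * f n)) (r * S) := by
  rw [← hasSum_nat_add_iff' 1]
  simp only [Finset.range_one, Finset.sum_singleton, Nat.cast_zero, zero_mul, mul_zero, sub_zero]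
  refine (h.mul_left (r : ℝ)).congr_fun ?_
  intro n
  rw [Nat.factorial_succ]
  have : (n.factorial : ℝ) ≠ 0 := by positivity
  push_cast
  field_simp
  ring

lemma hasSum_poisson_pow (r : ℝ≥0) (x : ℝ) :
    HasSum (fun n : ℕ => Real.exp (-r) * r ^ n / n.factorial * x ^ n)
      (Real.exp ((x - 1) * r)) := by
  have h := (NormedSpace.expSeries_div_hasSum_exp ((r : ℝ) * x)).mul_left (Real.exp (-r))
  rw [← Real.exp_eq_exp_ℝ, ← Real.exp_add] at h
  have e : (x - 1) * (r : ℝ) = -r + r * x := by ring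
  rw [e]
  exact h.congr_fun fun n => by rw [mul_pow]; ring

lemma covariance_congr_of_ae_eq {Ω : Type*} [MeasurableSpace Ω] {P : Measure Ω}
    {U U' V V' : Ω → ℝ} (hU : U =ᵐ[P] U') (hV : V =ᵐ[P] V') : cov[U, V; P] = cov[U', V'; P] := by
  unfold covariance
  rw [integral_congr_ae hU, integral_congr_ae hV]
  refine integral_congr_ae ?_
  filter_upwards [hU, hV] with ω h1 h2
  rw [h1, h2]

/-! ### The counting variables `N(A)` -/

namespace IsPoissonMeasure

variable {X : Type*} [MeasurableSpace X] {μ : Measure X} {P : Measure (Measure X)}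
  {A B : Set X}

lemma measurable_real (hA : MeasurableSet A) : Measurable fun ξ : Measure X => ξ.real A :=
  (Measure.measurable_coe hA).ennreal_toReal

lemma ae_eval_eq_natCast (hP : IsPoissonMeasure μ P) (hA : MeasurableSet A) (hμA : μ A ≠ ∞) :
    ∀ᵐ ξ : Measure X ∂P, ∃ k : ℕ, ξ A = (k : ℝ≥0∞) := by
  have hm : Measurable fun k : ℕ => (k : ℝ≥0∞) := measurable_of_countable _
  have hr : MeasurableSet (Set.range fun k : ℕ => (k : ℝ≥0∞)) :=
    (Set.countable_range _).measurableSet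
  have h : ∀ᵐ y ∂(P.map fun ξ : Measure X => ξ A), y ∈ Set.range fun k : ℕ => (k : ℝ≥0∞) := by
    rw [hP.map_eval A hA hμA]
    exact (ae_map_iff hm.aemeasurable hr).2 (.of_forall fun k => ⟨k, rfl⟩)
  filter_upwards [(ae_map_iff (Measure.measurable_coe hA).aemeasurable hr).1 h] with ξ hξ
  obtain ⟨k, hk⟩ := hξ
  exact ⟨k, hk.symm⟩

lemma map_real (hP : IsPoissonMeasure μ P) (hA : MeasurableSet A) (hμA : μ A ≠ ∞) :
    P.map (fun ξ : Measure X => ξ.real A)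
      = (poissonMeasure (μ A).toNNReal).map (fun k : ℕ => (k : ℝ)) := by
  have h := congrArg (Measure.map ENNReal.toReal) (hP.map_eval A hA hμA)
  rw [Measure.map_map ENNReal.measurable_toReal (Measure.measurable_coe hA),
    Measure.map_map ENNReal.measurable_toReal (measurable_of_countable _)] at h
  simpa [Function.comp_def, measureReal_def] using h

/-- The expectation of a nonnegative function of `N(A)`, as a sum over the Poisson weights. -/
lemma integrable_comp_and_integral_comp (hP : IsPoissonMeasure μ P) (hA : MeasurableSet A)
    (hμA : μ A ≠ ∞) {f : ℝ → ℝ} (hf : Measurable f) (hpos : ∀ n : ℕ, 0 ≤ f n) {S : ℝ}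
    (hS : HasSum (fun n : ℕ => Real.exp (-(μ A).toNNReal) * (μ A).toNNReal ^ n / n.factorial
      * f n) S) :
    Integrable (fun ξ : Measure X => f (ξ.real A)) P ∧ ∫ ξ, f (ξ.real A) ∂P = S := by
  have hm := measurable_real hA
  have hc : Measurable fun k : ℕ => (k : ℝ) := measurable_of_countable _
  have hi : Integrable (fun k : ℕ => f k) (poissonMeasure (μ A).toNNReal) := by
    rw [integrable_poissonMeasure_iff]
    refine hS.summable.congr fun n => ?_
    rw [Real.norm_of_nonneg (hpos n)]
  constructor
  · have h2 : Integrable f (P.map fun ξ : Measure X => ξ.real A) := by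
      rw [hP.map_real hA hμA, integrable_map_measure hf.aestronglyMeasurable hc.aemeasurable]
      exact hi
    exact (integrable_map_measure hf.aestronglyMeasurable hm.aemeasurable).1 h2
  · rw [← integral_map (φ := fun ξ : Measure X => ξ.real A) hm.aemeasurable
      hf.aestronglyMeasurable, hP.map_real hA hμA, integral_map hc.aemeasurable
      hf.aestronglyMeasurable]
    exact (hasSum_integral_poissonMeasure hi).unique hS

lemma toNNReal_coe_eq_real : (((μ A).toNNReal : ℝ≥0) : ℝ) = μ.real A := rfl

lemma integrable_rpow (hP : IsPoissonMeasure μ P) (hA : MeasurableSet A) (hμA : μ A ≠ ∞)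
    {x : ℝ} (hx : 0 ≤ x) : Integrable (fun ξ : Measure X => x ^ ξ.real A) P := by
  refine (hP.integrable_comp_and_integral_comp hA hμA (f := fun t => x ^ t)
    (by fun_prop) (fun n => by positivity) (S := Real.exp ((x - 1) * μ.real A)) ?_).1
  exact (hasSum_poisson_pow _ x).congr_fun fun n => by rw [Real.rpow_natCast]

lemma integral_rpow (hP : IsPoissonMeasure μ P) (hA : MeasurableSet A) (hμA : μ A ≠ ∞)
    {x : ℝ} (hx : 0 ≤ x) : ∫ ξ, x ^ ξ.real A ∂P = Real.exp ((x - 1) * μ.real A) := by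
  refine (hP.integrable_comp_and_integral_comp hA hμA (f := fun t => x ^ t)
    (by fun_prop) (fun n => by positivity) ?_).2
  exact (hasSum_poisson_pow _ x).congr_fun fun n => by rw [Real.rpow_natCast]

lemma integrable_mul_rpow_and_integral (hP : IsPoissonMeasure μ P) (hA : MeasurableSet A)
    (hμA : μ A ≠ ∞) {x : ℝ} (hx : 0 ≤ x) :
    Integrable (fun ξ : Measure X => ξ.real A * x ^ ξ.real A) P ∧
    ∫ ξ, ξ.real A * x ^ ξ.real A ∂P = μ.real A * (Real.exp ((x - 1) * μ.real A) * x) := by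
  refine hP.integrable_comp_and_integral_comp hA hμA (f := fun t => t * x ^ t)
    (by fun_prop) (fun n => by positivity) ?_
  simp only [Real.rpow_natCast]
  refine hasSum_poisson_shift (f := fun n => x ^ n) ?_
  exact ((hasSum_poisson_pow _ x).mul_right x).congr_fun fun n => by rw [pow_succ]; ring

lemma integrable_real (hP : IsPoissonMeasure μ P) (hA : MeasurableSet A) (hμA : μ A ≠ ∞) :
    Integrable (fun ξ : Measure X => ξ.real A) P := by
  simpa using (hP.integrable_mul_rpow_and_integral hA hμA zero_le_one).1

lemma integral_real (hP : IsPoissonMeasure μ P) (hA : MeasurableSet A) (hμA : μ A ≠ ∞) :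
    ∫ ξ, ξ.real A ∂P = μ.real A := by
  simpa using (hP.integrable_mul_rpow_and_integral hA hμA zero_le_one).2

lemma integrable_sq_real_and_integral (hP : IsPoissonMeasure μ P) (hA : MeasurableSet A)
    (hμA : μ A ≠ ∞) :
    Integrable (fun ξ : Measure X => ξ.real A ^ 2) P ∧
    ∫ ξ, ξ.real A ^ 2 ∂P = μ.real A * (μ.real A + 1) := by
  refine hP.integrable_comp_and_integral_comp hA hμA (f := fun t => t ^ 2)
    (by fun_prop) (fun n => by positivity) ?_
  have h1 : HasSum (fun n : ℕ => Real.exp (-(μ A).toNNReal) * (μ A).toNNReal ^ n / n.factorial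
      * ((n + 1 : ℕ) : ℝ)) (μ.real A + 1) := by
    have h := hasSum_poisson_pow (μ A).toNNReal 1
    simp only [one_pow, mul_one, sub_self, zero_mul, Real.exp_zero] at h
    have h' := hasSum_poisson_shift (r := (μ A).toNNReal) (f := fun _ => 1) (by simpa using h)
    refine ((h'.add h).congr_fun fun n => by push_cast; ring).trans ?_
    simp [toNNReal_coe_eq_real]
  exact (hasSum_poisson_shift (f := fun n => (n : ℝ)) h1).congr_fun fun n => by rw [sq]

lemma memLp_real (hP : IsPoissonMeasure μ P) (hA : MeasurableSet A) (hμA : μ A ≠ ∞) :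
    MemLp (fun ξ : Measure X => ξ.real A) 2 P :=
  (memLp_two_iff_integrable_sq (measurable_real hA).aestronglyMeasurable).2
    (hP.integrable_sq_real_and_integral hA hμA).1

lemma memLp_rpow (hP : IsPoissonMeasure μ P) (hA : MeasurableSet A) (hμA : μ A ≠ ∞)
    {x : ℝ} (hx : 0 ≤ x) : MemLp (fun ξ : Measure X => x ^ ξ.real A) 2 P := by
  have hm := measurable_real hA
  refine (memLp_two_iff_integrable_sq (hm.const_pow x).aestronglyMeasurable).2 ?_
  refine (hP.integrable_rpow hA hμA (sq_nonneg x)).congr (.of_forall fun ξ => ?_)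
  simp only
  rw [← Real.rpow_natCast, ← Real.rpow_natCast, ← Real.rpow_mul hx, ← Real.rpow_mul hx, mul_comm]

lemma indepFun_real (hP : IsPoissonMeasure μ P) (hA : MeasurableSet A) (hμA : μ A ≠ ∞)
    (hB : MeasurableSet B) (hμB : μ B ≠ ∞) (hAB : Disjoint A B) :
    IndepFun (fun ξ : Measure X => ξ.real A) (fun ξ : Measure X => ξ.real B) P := by
  have h := hP.indep 2 ![A, B] (by simp [Fin.forall_fin_two, hA, hB])
    (by simp [Fin.forall_fin_two, hμA, hμB])
    (by simp [Fin.forall_fin_two, hAB, hAB.symm])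
  have h01 := h.indepFun (show (0 : Fin 2) ≠ 1 by decide)
  exact h01.comp ENNReal.measurable_toReal ENNReal.measurable_toReal

/-- Additivity of the real-valued counts; it fails at the junk value `∞.toReal = 0`, which
almost surely does not occur. -/
lemma ae_real_eq_inter_add_diff (hP : IsPoissonMeasure μ P) (hA : MeasurableSet A)
    (hμA : μ A ≠ ∞) (hB : MeasurableSet B) :
    ∀ᵐ ξ ∂P, ξ.real A = ξ.real (A ∩ B) + ξ.real (A \ B) := by
  filter_upwards [hP.ae_eval_eq_natCast hA hμA] with ξ ⟨k, hk⟩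
  exact (measureReal_inter_add_sdiff hB (by simp [hk])).symm

variable [IsProbabilityMeasure P]

lemma variance_real (hP : IsPoissonMeasure μ P) (hA : MeasurableSet A) (hμA : μ A ≠ ∞) :
    Var[fun ξ : Measure X => ξ.real A; P] = μ.real A := by
  rw [variance_eq_sub (hP.memLp_real hA hμA), hP.integral_real hA hμA]
  have := (hP.integrable_sq_real_and_integral hA hμA).2
  simp only [Pi.pow_apply]
  rw [this]
  ring

lemma covariance_real (hP : IsPoissonMeasure μ P) (hA : MeasurableSet A) (hμA : μ A ≠ ∞)
    (hB : MeasurableSet B) (hμB : μ B ≠ ∞) :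
    cov[fun ξ : Measure X => ξ.real A, fun ξ : Measure X => ξ.real B; P] = μ.real (A ∩ B) := by
  have hC := hA.inter hB
  have hμC : μ (A ∩ B) ≠ ∞ := measure_ne_top_of_subset Set.inter_subset_left hμA
  have hD := hA.diff hB
  have hμD : μ (A \ B) ≠ ∞ := measure_ne_top_of_subset Set.sdiff_subset hμA
  have hE := hB.diff hA
  have hμE : μ (B \ A) ≠ ∞ := measure_ne_top_of_subset Set.sdiff_subset hμB
  have lC := hP.memLp_real hC hμC
  have lD := hP.memLp_real hD hμD
  have lE := hP.memLp_real hE hμE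
  have e1 : (fun ξ : Measure X => ξ.real A) =ᵐ[P]
      (fun ξ => ξ.real (A ∩ B)) + fun ξ => ξ.real (A \ B) :=
    hP.ae_real_eq_inter_add_diff hA hμA hB
  have e2 : (fun ξ : Measure X => ξ.real B) =ᵐ[P]
      (fun ξ => ξ.real (A ∩ B)) + fun ξ => ξ.real (B \ A) := by
    have := hP.ae_real_eq_inter_add_diff hB hμB hA
    rwa [Set.inter_comm] at this
  rw [covariance_congr_of_ae_eq e1 e2, covariance_add_left lC lD (lC.add lE),
    covariance_add_right lC lC lE, covariance_add_right lD lC lE,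
    covariance_self lC.1.aemeasurable, hP.variance_real hC hμC,
    (hP.indepFun_real hC hμC hE hμE
      (Set.disjoint_left.2 fun x hx hy => hy.2 hx.1)).covariance_eq_zero lC lE,
    (hP.indepFun_real hD hμD hC hμC
      (Set.disjoint_left.2 fun x hx hy => hx.2 hy.2)).covariance_eq_zero lD lC,
    (hP.indepFun_real hD hμD hE hμE
      (Set.disjoint_left.2 fun x hx hy => hy.2 hx.1)).covariance_eq_zero lD lE]
  simp

/-- The variable `x ^ N(A)` is an exponential tilt: under the density `x ^ N(A) / E[x ^ N(A)]`,
the intensity of the process is multiplied by `x` on `A` and left unchanged off `A`. -/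
lemma integral_centered_mul_rpow (hP : IsPoissonMeasure μ P) (hA : MeasurableSet A)
    (hμA : μ A ≠ ∞) (hB : MeasurableSet B) (hμB : μ B ≠ ∞) {x : ℝ} (hx : 0 ≤ x) :
    ∫ ξ, x ^ ξ.real A * (ξ.real B - μ.real B) ∂P
      = (x - 1) * Real.exp ((x - 1) * μ.real A) * μ.real (A ∩ B) := by
  have hC := hA.inter hB
  have hμC : μ (A ∩ B) ≠ ∞ := measure_ne_top_of_subset Set.inter_subset_left hμA
  have hD := hA.diff hB
  have hμD : μ (A \ B) ≠ ∞ := measure_ne_top_of_subset Set.sdiff_subset hμA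
  have hE := hB.diff hA
  have hμE : μ (B \ A) ≠ ∞ := measure_ne_top_of_subset Set.sdiff_subset hμB
  have mA := measurable_real hA
  have mC := measurable_real hC
  have mD := measurable_real hD
  have mE := measurable_real hE
  have i1 := hP.integrable_mul_rpow_and_integral hC hμC hx
  have iC := hP.integrable_rpow hC hμC hx
  have iD := hP.integrable_rpow hD hμD hx
  have indCD : IndepFun (fun ξ : Measure X => ξ.real (A ∩ B) * x ^ ξ.real (A ∩ B)
      - μ.real (A ∩ B) * x ^ ξ.real (A ∩ B)) (fun ξ : Measure X => x ^ ξ.real (A \ B)) P :=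
    (hP.indepFun_real hC hμC hD hμD (Set.disjoint_left.2 fun y hy hz => hz.2 hy.2)).comp
      (φ := fun t => t * x ^ t - μ.real (A ∩ B) * x ^ t) (ψ := fun t => x ^ t)
      (by fun_prop) (by fun_prop)
  have indAE : IndepFun (fun ξ : Measure X => x ^ ξ.real A)
      (fun ξ : Measure X => ξ.real (B \ A) - μ.real (B \ A)) P :=
    (hP.indepFun_real hA hμA hE hμE (Set.disjoint_left.2 fun y hy hz => hz.2 hy)).comp
      (φ := fun t => x ^ t) (ψ := fun t => t - μ.real (B \ A)) (by fun_prop) (by fun_prop)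
  have iCE : Integrable (fun ξ : Measure X => ξ.real (A ∩ B) * x ^ ξ.real (A ∩ B)
      - μ.real (A ∩ B) * x ^ ξ.real (A ∩ B)) P := i1.1.sub (iC.const_mul _)
  have iA := hP.integrable_rpow hA hμA hx
  have iE : Integrable (fun ξ : Measure X => ξ.real (B \ A) - μ.real (B \ A)) P :=
    (hP.integrable_real hE hμE).sub (integrable_const _)
  have iCD : Integrable (fun ξ : Measure X => (ξ.real (A ∩ B) * x ^ ξ.real (A ∩ B)
      - μ.real (A ∩ B) * x ^ ξ.real (A ∩ B)) * x ^ ξ.real (A \ B)) P :=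
    indCD.integrable_mul iCE iD
  have iAE : Integrable (fun ξ : Measure X => x ^ ξ.real A * (ξ.real (B \ A) - μ.real (B \ A))) P :=
    indAE.integrable_mul iA iE
  -- `N(A ∩ B)` and `N(A \ B)` are independent, and so are `N(A)` and `N(B \ A)`.
  have hsplit : (fun ξ : Measure X => x ^ ξ.real A * (ξ.real B - μ.real B)) =ᵐ[P] fun ξ =>
      (ξ.real (A ∩ B) * x ^ ξ.real (A ∩ B) - μ.real (A ∩ B) * x ^ ξ.real (A ∩ B))
        * x ^ ξ.real (A \ B) + x ^ ξ.real A * (ξ.real (B \ A) - μ.real (B \ A)) := by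
    filter_upwards [hP.ae_real_eq_inter_add_diff hA hμA hB,
      hP.ae_real_eq_inter_add_diff hB hμB hA] with ξ h1 h2
    have h3 : x ^ ξ.real A = x ^ ξ.real (A ∩ B) * x ^ ξ.real (A \ B) := by
      rw [h1, Real.rpow_add_of_nonneg hx measureReal_nonneg measureReal_nonneg]
    have h4 := measureReal_inter_add_sdiff (s := B) hA hμB
    rw [h2, ← h4, Set.inter_comm B A, h3]
    ring
  rw [integral_congr_ae hsplit, integral_add iCD iAE,
    indCD.integral_fun_mul_eq_mul_integral iCE.1 iD.1,
    indAE.integral_fun_mul_eq_mul_integral iA.1 iE.1, integral_sub i1.1 (iC.const_mul _), i1.2,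
    integral_const_mul, hP.integral_rpow hC hμC hx, hP.integral_rpow hD hμD hx,
    integral_sub (hP.integrable_real hE hμE) (integrable_const _), hP.integral_real hE hμE]
  rw [← measureReal_inter_add_sdiff (s := A) hB hμA, mul_add, Real.exp_add]
  simp
  ring

end IsPoissonMeasure

/-! ### Isometries and indicators in `L²` -/

/-- Two families of vectors with the same Gram matrix are related by a linear isometry, defined
on the whole space when the first family is total. -/
lemma exists_linearIsometry_of_inner_eq {ι H K : Type*} [NormedAddCommGroup H]
    [InnerProductSpace ℂ H] [NormedAddCommGroup K] [InnerProductSpace ℂ K] [CompleteSpace K]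
    (v : ι → H) (w : ι → K) (h : ∀ i j, inner ℂ (v i) (v j) = inner ℂ (w i) (w j))
    (hv : Dense (Submodule.span ℂ (Set.range v) : Set H)) :
    ∃ T : H →ₗᵢ[ℂ] K, ∀ i, T (v i) = w i := by
  set e := Finsupp.linearCombination ℂ v
  set f := Finsupp.linearCombination ℂ w
  have hef : ∀ c, ‖f c‖ = ‖e c‖ := fun c => by
    have : inner ℂ (f c) (f c) = inner ℂ (e c) (e c) := by
      simp only [e, f, Finsupp.linearCombination_apply, Finsupp.sum, sum_inner, inner_sum,
        inner_smul_left, inner_smul_right, h]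
    rw [inner_self_eq_norm_sq_to_K, inner_self_eq_norm_sq_to_K] at this
    have h2 : ‖f c‖ ^ 2 = ‖e c‖ ^ 2 := by exact_mod_cast this
    exact (sq_eq_sq₀ (norm_nonneg _) (norm_nonneg _)).1 h2
  have hd : DenseRange e := by
    have : Set.range e = (Submodule.span ℂ (Set.range v) : Set H) := by
      rw [← Finsupp.range_linearCombination, LinearMap.coe_range]
    rw [DenseRange, this]
    exact hv
  have hb : ∃ C : ℝ, ∀ c, ‖f c‖ ≤ C * ‖e c‖ := ⟨1, fun c => by rw [hef, one_mul]⟩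
  have hT : ∀ c, f.extendOfNorm e (e c) = f c := fun c => LinearMap.extendOfNorm_eq hd hb c
  refine ⟨⟨(f.extendOfNorm e : H →ₗ[ℂ] K), fun x => ?_⟩, fun i => ?_⟩
  · refine hd.induction_on (p := fun x => ‖f.extendOfNorm e x‖ = ‖x‖) x ?_ fun c => ?_
    · exact isClosed_eq (f.extendOfNorm e).continuous.norm continuous_norm
    · rw [hT, hef]
  · have := hT (Finsupp.single i 1)
    simpa [e, f] using this

lemma smul_indicatorConstLp_one {X : Type*} [MeasurableSpace X] {μ : Measure X} {A : Set X}
    (hA : MeasurableSet A) (hμA : μ A ≠ ∞) (c : ℂ) :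
    c • indicatorConstLp 2 hA hμA (1 : ℂ) = indicatorConstLp 2 hA hμA c := by
  refine (MemLp.toLp_const_smul c _).symm.trans (MemLp.toLp_congr _ _ (.of_forall fun x => ?_))
  by_cases hx : x ∈ A <;> simp [hx]

lemma dense_span_indicatorConstLp {X : Type*} [MeasurableSpace X] (μ : Measure X) :
    Dense (Submodule.span ℂ (Set.range fun A : {A : Set X // MeasurableSet A ∧ μ A ≠ ∞} =>
      indicatorConstLp 2 A.2.1 A.2.2 (1 : ℂ)) : Set (Lp ℂ 2 μ)) := by
  intro f
  induction f using Lp.induction (p := 2) ENNReal.ofNat_ne_top with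
  | indicatorConst c hs hμs =>
    refine subset_closure ?_
    have : (Lp.simpleFunc.indicatorConst 2 hs hμs.ne c : Lp ℂ 2 μ)
        = c • indicatorConstLp 2 hs hμs.ne (1 : ℂ) := by
      rw [Lp.simpleFunc.coe_indicatorConst, smul_indicatorConstLp_one]
    rw [this]
    exact Submodule.smul_mem _ _ (Submodule.subset_span ⟨⟨_, hs, hμs.ne⟩, rfl⟩)
  | add hf hg _ h1 h2 =>
    rw [← Submodule.topologicalClosure_coe] at *
    exact Submodule.add_mem _ h1 h2
  | isClosed => exact isClosed_closure

lemma inner_indicatorConstLp_one_eq_setIntegral {X : Type*} [MeasurableSpace X] {μ : Measure X}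
    {A : Set X} (hA : MeasurableSet A) (hμA : μ A ≠ ∞) (f : Lp ℂ 2 μ) :
    inner ℂ (indicatorConstLp 2 hA hμA (1 : ℂ)) f = ∫ x in A, f x ∂μ :=
  L2.inner_indicatorConstLp_one hA hμA f

namespace IsPoissonMeasure

variable {X : Type*} [MeasurableSpace X] {μ : Measure X} {P : Measure (Measure X)}
  {A B : Set X}

/-! ### Campbell's formula -/

/-- The intensity measure of the process is `μ`. -/
lemma join_eq [SigmaFinite μ] (hP : IsPoissonMeasure μ P) : P.join = μ := by
  have hfin : ∀ A, MeasurableSet A → μ A ≠ ∞ → P.join A = μ A := fun A hA hμA => by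
    have h1 : ∫⁻ ξ, ξ A ∂P = ∫⁻ ξ, ENNReal.ofReal (ξ.real A) ∂P := by
      refine lintegral_congr_ae ?_
      filter_upwards [hP.ae_eval_eq_natCast hA hμA] with ξ ⟨k, hk⟩
      rw [measureReal_def, ENNReal.ofReal_toReal (by simp [hk])]
    rw [Measure.join_apply hA, h1, ← ofReal_integral_eq_lintegral_ofReal
      (hP.integrable_real hA hμA) (.of_forall fun ξ => measureReal_nonneg),
      hP.integral_real hA hμA, measureReal_def, ENNReal.ofReal_toReal hμA]
  ext A hA
  have hU : A = ⋃ n, A ∩ spanningSets μ n := by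
    rw [← Set.inter_iUnion, iUnion_spanningSets, Set.inter_univ]
  have hmono : Monotone fun n => A ∩ spanningSets μ n := fun i j hij =>
    Set.inter_subset_inter_right _ (monotone_spanningSets μ hij)
  rw [hU, hmono.measure_iUnion, hmono.measure_iUnion]
  refine iSup_congr fun n => hfin _ (hA.inter (measurableSet_spanningSets μ n)) ?_
  exact measure_ne_top_of_subset Set.inter_subset_right (measure_spanningSets_lt_top μ n).ne

lemma ae_ae [SigmaFinite μ] (hP : IsPoissonMeasure μ P) {p : X → Prop} (h : ∀ᵐ x ∂μ, p x) :
    ∀ᵐ ξ ∂P, ∀ᵐ x ∂ξ, p x :=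
  Measure.ae_ae_of_ae_join (by rwa [hP.join_eq])

lemma lintegral_lintegral [SigmaFinite μ] (hP : IsPoissonMeasure μ P) {f : X → ℝ≥0∞}
    (hf : AEMeasurable f μ) : ∫⁻ ξ, ∫⁻ x, f x ∂ξ ∂P = ∫⁻ x, f x ∂μ := by
  rw [← Measure.lintegral_join (by rwa [hP.join_eq]), hP.join_eq]

lemma aemeasurable_lintegral [SigmaFinite μ] (hP : IsPoissonMeasure μ P) {f : X → ℝ≥0∞}
    (hf : AEMeasurable f μ) : AEMeasurable (fun ξ : Measure X => ∫⁻ x, f x ∂ξ) P :=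
  Measure.aemeasurable_lintegral (by rwa [hP.join_eq])

lemma ae_integrable [SigmaFinite μ] (hP : IsPoissonMeasure μ P) {E : Type*}
    [NormedAddCommGroup E] {f : X → E} (hf : Integrable f μ) : ∀ᵐ ξ ∂P, Integrable f ξ := by
  have h1 : ∀ᵐ ξ ∂P, ∫⁻ x, ‖f x‖ₑ ∂ξ < ∞ := by
    refine ae_lt_top' (hP.aemeasurable_lintegral hf.1.enorm) ?_
    rw [hP.lintegral_lintegral hf.1.enorm]
    exact hf.2.ne
  filter_upwards [h1, hP.ae_ae hf.1.ae_eq_mk] with ξ h h2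
  exact ⟨⟨_, hf.1.stronglyMeasurable_mk, h2⟩, h⟩

/-! ### The centered stochastic integral -/

variable [IsProbabilityMeasure P]

lemma memLp_centered_real (hP : IsPoissonMeasure μ P) (hA : MeasurableSet A) (hμA : μ A ≠ ∞) :
    MemLp (fun ξ : Measure X => ((ξ.real A - μ.real A : ℝ) : ℂ)) 2 P :=
  ((hP.memLp_real hA hμA).sub (memLp_const _)).ofReal

lemma exists_centeredIntegral (hP : IsPoissonMeasure μ P) :
    ∃ T : Lp ℂ 2 μ →ₗᵢ[ℂ] Lp ℂ 2 P, ∀ A : {A : Set X // MeasurableSet A ∧ μ A ≠ ∞},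
      T (indicatorConstLp 2 A.2.1 A.2.2 1) = (hP.memLp_centered_real A.2.1 A.2.2).toLp _ := by
  refine exists_linearIsometry_of_inner_eq _ _ ?_ (dense_span_indicatorConstLp μ)
  rintro ⟨A, hA, hμA⟩ ⟨B, hB, hμB⟩
  have hc := hP.covariance_real hA hμA hB hμB
  rw [covariance, hP.integral_real hA hμA, hP.integral_real hB hμB] at hc
  rw [L2.inner_indicatorConstLp_one_indicatorConstLp_one hA hB, ← hc, L2.inner_def]
  refine (integral_ofReal (𝕜 := ℂ)).symm.trans (integral_congr_ae ?_)
  filter_upwards [(hP.memLp_centered_real hA hμA).coeFn_toLp,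
    (hP.memLp_centered_real hB hμB).coeFn_toLp] with ξ h1 h2
  rw [h1, h2]
  simp only [RCLike.inner_apply, Complex.conj_ofReal, Complex.coe_algebraMap]
  push_cast
  ring

/-- The centered stochastic integral as an isometry `L²(μ) → L²(P)`, the one that maps the
indicator of a set `A` of finite measure to `N(A) - μ(A)`. -/
noncomputable def centeredIntegral (hP : IsPoissonMeasure μ P) : Lp ℂ 2 μ →ₗᵢ[ℂ] Lp ℂ 2 P :=
  hP.exists_centeredIntegral.choose

lemma centeredIntegral_indicatorConstLp (hP : IsPoissonMeasure μ P) (hA : MeasurableSet A)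
    (hμA : μ A ≠ ∞) : hP.centeredIntegral (indicatorConstLp 2 hA hμA 1)
      = (hP.memLp_centered_real hA hμA).toLp _ :=
  hP.exists_centeredIntegral.choose_spec ⟨A, hA, hμA⟩

lemma centeredIntegral_toLp_simpleFunc [SigmaFinite μ] (hP : IsPoissonMeasure μ P)
    (s : SimpleFunc X ℂ) (hs : MemLp s 2 μ) :
    ∀ᵐ ξ ∂P, hP.centeredIntegral (hs.toLp s) ξ = (∫ x, s x ∂ξ) - ∫ x, s x ∂μ := by
  induction s using SimpleFunc.induction with
  | const c hA =>
    rename_i A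
    by_cases hc : c = 0
    · subst hc
      have : hs.toLp (⇑(SimpleFunc.piecewise A hA (SimpleFunc.const X (0 : ℂ))
          (SimpleFunc.const X 0))) = 0 := by
        refine (MemLp.toLp_congr hs (MemLp.zero) (.of_forall fun x => ?_)).trans
          (MemLp.toLp_zero _)
        simp
      rw [this, map_zero]
      filter_upwards [Lp.coeFn_zero ℂ 2 P] with ξ h
      rw [h]
      simp
    have hμA : μ A ≠ ∞ := (SimpleFunc.measure_lt_top_of_memLp_indicator (by simp) (by simp)
      hc hA hs).ne
    have e : hs.toLp _ = c • indicatorConstLp 2 hA hμA (1 : ℂ) := by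
      rw [smul_indicatorConstLp_one]
      refine MemLp.toLp_congr _ _ (.of_forall fun x => ?_)
      simp [Set.indicator, Set.piecewise]
    rw [e, map_smul, hP.centeredIntegral_indicatorConstLp]
    filter_upwards [Lp.coeFn_smul c ((hP.memLp_centered_real hA hμA).toLp _),
      (hP.memLp_centered_real hA hμA).coeFn_toLp] with ξ h1 h2
    rw [h1, Pi.smul_apply, h2]
    simp [integral_indicator hA]
    ring
  | @add f g hfg ihf ihg =>
    have hfg' : MemLp (f : X → ℂ) 2 μ ∧ MemLp (g : X → ℂ) 2 μ :=
      (memLp_add_of_disjoint hfg f.stronglyMeasurable g.stronglyMeasurable).1 hs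
    have e : hs.toLp _ = hfg'.1.toLp f + hfg'.2.toLp g := (MemLp.toLp_add hfg'.1 hfg'.2).symm
    have i1 : Integrable f μ := SimpleFunc.integrable_iff.2
      ((SimpleFunc.memLp_iff (by simp) (by simp)).1 hfg'.1)
    have i2 : Integrable g μ := SimpleFunc.integrable_iff.2
      ((SimpleFunc.memLp_iff (by simp) (by simp)).1 hfg'.2)
    rw [e, map_add]
    filter_upwards [Lp.coeFn_add (hP.centeredIntegral (hfg'.1.toLp f))
      (hP.centeredIntegral (hfg'.2.toLp g)), ihf hfg'.1, ihg hfg'.2, hP.ae_integrable i1,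
      hP.ae_integrable i2] with ξ h1 h2 h3 h4 h5
    rw [h1, Pi.add_apply, h2, h3]
    simp only [SimpleFunc.coe_add, Pi.add_apply]
    rw [integral_add i1 i2, integral_add h4 h5]
    ring

/-- For an integrable `g`, the centered integral is the pathwise one. Simple functions
approximate `g` in `L¹` and in `L²` at the same time, and a bound of the distance between the two
sides by quantities whose expectations tend to zero forces them to agree. -/
lemma centeredIntegral_of_integrable [SigmaFinite μ] (hP : IsPoissonMeasure μ P)
    (g : Lp ℂ 2 μ) (hg : Integrable g μ) :
    ∀ᵐ ξ ∂P, hP.centeredIntegral g ξ = (∫ x, g x ∂ξ) - ∫ x, g x ∂μ := by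
  have gm : Measurable (g : X → ℂ) := (Lp.stronglyMeasurable g).measurable
  have g2 : MemLp g 2 μ := Lp.memLp g
  set s : ℕ → SimpleFunc X ℂ := fun n =>
    SimpleFunc.approxOn g gm (Set.range g ∪ {0}) 0 (by simp) n
  have s2 : ∀ n, MemLp (s n) 2 μ := fun n => SimpleFunc.memLp_approxOn_range gm g2 n
  have s1 : ∀ n, Integrable (s n) μ := fun n => SimpleFunc.integrable_approxOn_range gm hg n
  have hs2 : Tendsto (fun n => (s2 n).toLp (s n)) atTop (𝓝 g) := by
    have := SimpleFunc.tendsto_approxOn_range_Lp (p := 2) (by simp) gm g2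
    rwa [Lp.toLp_coeFn] at this
  have hs1 : Tendsto (fun n => ∫⁻ x, ‖s n x - g x‖ₑ ∂μ) atTop (𝓝 0) :=
    SimpleFunc.tendsto_approxOn_range_L1_enorm gm hg
  -- For every `n`, `D n ξ` bounds the distance between the two sides at `ξ`.
  set D : ℕ → Measure X → ℝ≥0∞ := fun n ξ =>
    ‖(hP.centeredIntegral g - hP.centeredIntegral ((s2 n).toLp (s n)) : Lp ℂ 2 P) ξ‖ₑ
      + ((∫⁻ x, ‖s n x - g x‖ₑ ∂ξ) + ∫⁻ x, ‖s n x - g x‖ₑ ∂μ) with hD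
  have am : ∀ n, AEMeasurable (fun x => ‖s n x - g x‖ₑ) μ := fun n =>
    ((s1 n).sub hg).1.enorm
  have Dm : ∀ n, AEMeasurable (D n) P := fun n =>
    (Lp.aestronglyMeasurable _).enorm.add
      ((hP.aemeasurable_lintegral (am n)).add aemeasurable_const)
  have Dlim : Tendsto (fun n => ∫⁻ ξ, D n ξ ∂P) atTop (𝓝 0) := by
    have hle : ∀ n, ∫⁻ ξ, D n ξ ∂P ≤ ‖g - (s2 n).toLp (s n)‖ₑ
        + ((∫⁻ x, ‖s n x - g x‖ₑ ∂μ) + ∫⁻ x, ‖s n x - g x‖ₑ ∂μ) := fun n => by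
      rw [hD, lintegral_add_left' (Lp.aestronglyMeasurable _).enorm,
        lintegral_add_left' (hP.aemeasurable_lintegral (am n)), hP.lintegral_lintegral (am n),
        lintegral_const, measure_univ, mul_one]
      gcongr
      rw [← eLpNorm_one_eq_lintegral_enorm]
      refine (eLpNorm_le_eLpNorm_of_exponent_le (q := 2) (by norm_num)
        (Lp.aestronglyMeasurable _)).trans ?_
      rw [← Lp.enorm_def, ← map_sub, enorm_eq_iff_norm_eq.2 (hP.centeredIntegral.norm_map _)]
    refine tendsto_of_tendsto_of_tendsto_of_le_of_le tendsto_const_nhds ?_ (fun _ => zero_le) hle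
    have h0 : Tendsto (fun n => ‖g - (s2 n).toLp (s n)‖ₑ) atTop (𝓝 0) := by
      have := (tendsto_const_nhds (x := g)).sub hs2
      simpa using this.enorm
    simpa using h0.add (hs1.add hs1)
  have hlim : ∫⁻ ξ, ⨅ n, D n ξ ∂P = 0 := by
    refine le_antisymm (ge_of_tendsto' Dlim fun n => ?_) zero_le
    exact lintegral_mono fun ξ => iInf_le _ n
  rw [lintegral_eq_zero_iff' (.iInf Dm)] at hlim
  have hs : ∀ᵐ ξ ∂P, ∀ n, hP.centeredIntegral ((s2 n).toLp (s n)) ξ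
      = (∫ x, s n x ∂ξ) - ∫ x, s n x ∂μ :=
    ae_all_iff.2 fun n => hP.centeredIntegral_toLp_simpleFunc (s n) (s2 n)
  have hsub : ∀ᵐ ξ ∂P, ∀ n,
      (hP.centeredIntegral g - hP.centeredIntegral ((s2 n).toLp (s n)) : Lp ℂ 2 P) ξ
        = hP.centeredIntegral g ξ - hP.centeredIntegral ((s2 n).toLp (s n)) ξ :=
    ae_all_iff.2 fun n => Lp.coeFn_sub _ _
  have hsi : ∀ᵐ ξ ∂P, ∀ n, Integrable (s n) ξ := ae_all_iff.2 fun n => hP.ae_integrable (s1 n)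
  filter_upwards [hlim, hs, hsub, hsi, hP.ae_integrable hg] with ξ h0 h1 h2 h3 h4
  have key : ∀ n, ‖hP.centeredIntegral g ξ - ((∫ x, g x ∂ξ) - ∫ x, g x ∂μ)‖ₑ ≤ D n ξ := by
    intro n
    have e : hP.centeredIntegral g ξ - ((∫ x, g x ∂ξ) - ∫ x, g x ∂μ)
        = (hP.centeredIntegral g - hP.centeredIntegral ((s2 n).toLp (s n)) : Lp ℂ 2 P) ξ
          + ((∫ x, (s n x - g x) ∂ξ) - ∫ x, (s n x - g x) ∂μ) := by
      rw [h2, h1, integral_sub (h3 n) h4, integral_sub (s1 n) hg]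
      ring
    rw [e]
    refine (enorm_add_le _ _).trans ?_
    refine add_le_add le_rfl ?_
    exact enorm_sub_le.trans (add_le_add (enorm_integral_le_lintegral_enorm _)
      (enorm_integral_le_lintegral_enorm _))
  have hle : ‖hP.centeredIntegral g ξ - ((∫ x, g x ∂ξ) - ∫ x, g x ∂μ)‖ₑ
      ≤ ⨅ n, D n ξ := le_iInf key
  rw [h0] at hle
  have := le_antisymm hle (zero_le)
  rwa [Pi.zero_apply, enorm_eq_zero, sub_eq_zero] at this

lemma isCenteredIntegral_iff [SigmaFinite μ] (hP : IsPoissonMeasure μ P) (g : Lp ℂ 2 μ)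
    (F : Lp ℂ 2 P) : IsCenteredIntegral μ P g F ↔ F = hP.centeredIntegral g := by
  constructor
  · rintro ⟨u, V, hu, hV, hug, hVF⟩
    have e : ∀ n, V n = hP.centeredIntegral (u n) := fun n => by
      refine Lp.ext ?_
      filter_upwards [hV n, hP.centeredIntegral_of_integrable (u n) (hu n)] with ξ h1 h2
      rw [h1, h2]
    refine tendsto_nhds_unique hVF ?_
    rw [funext e]
    exact (hP.centeredIntegral.continuous.tendsto g).comp hug
  · rintro rfl
    obtain ⟨u, hu, hug⟩ := mem_closure_iff_seq_limit.1 (dense_span_indicatorConstLp μ g)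
    have hint : ∀ f ∈ Submodule.span ℂ
        (Set.range fun A : {A : Set X // MeasurableSet A ∧ μ A ≠ ∞} =>
          indicatorConstLp 2 A.2.1 A.2.2 (1 : ℂ)), Integrable (f : X → ℂ) μ := by
      intro f hf
      induction hf using Submodule.span_induction with
      | mem f hf =>
        obtain ⟨⟨A, hA, hμA⟩, rfl⟩ := hf
        exact ((integrable_indicator_iff hA).2 (integrableOn_const hμA)).congr
          indicatorConstLp_coeFn.symm
      | zero => exact (integrable_zero X ℂ μ).congr (Lp.coeFn_zero ℂ 2 μ).symm
      | add f g _ _ h1 h2 => exact (h1.add h2).congr (Lp.coeFn_add f g).symm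
      | smul c f _ h => exact (h.smul c).congr (Lp.coeFn_smul c f).symm
    exact ⟨u, fun n => hP.centeredIntegral (u n), fun n => hint _ (hu n),
      fun n => hP.centeredIntegral_of_integrable _ (hint _ (hu n)), hug,
      (hP.centeredIntegral.continuous.tendsto g).comp hug⟩

lemma mem_firstChaos_iff [SigmaFinite μ] (hP : IsPoissonMeasure μ P) (F : Lp ℂ 2 P) :
    F ∈ firstChaos μ P ↔ ∃ g, F = hP.centeredIntegral g := by
  simp only [firstChaos, Set.mem_ofPred_eq, hP.isCenteredIntegral_iff]

end IsPoissonMeasure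

/-! ### Positivity and sets of finite measure -/

lemma ae_nonneg_of_forall_setIntegral_nonneg_complex {X : Type*} [MeasurableSpace X]
    {μ : Measure X} [SigmaFinite μ] {f : X → ℂ}
    (hf : ∀ A, MeasurableSet A → μ A < ∞ → IntegrableOn f A μ)
    (h : ∀ A, MeasurableSet A → μ A < ∞ → 0 ≤ ∫ x in A, f x ∂μ) : ∀ᵐ x ∂μ, 0 ≤ f x := by
  have h1 : 0 ≤ᵐ[μ] fun x => (f x).re :=
    ae_nonneg_of_forall_setIntegral_nonneg_of_sigmaFinite (fun A hA hμA => (hf A hA hμA).re)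
      fun A hA hμA => (integral_re (hf A hA hμA)).symm ▸ (Complex.nonneg_iff.1 (h A hA hμA)).1
  have h2 : (fun x => (f x).im) =ᵐ[μ] 0 :=
    ae_eq_zero_of_forall_setIntegral_eq_of_sigmaFinite (fun A hA hμA => (hf A hA hμA).im)
      fun A hA hμA =>
        (integral_im (hf A hA hμA)).trans (Complex.nonneg_iff.1 (h A hA hμA)).2.symm
  filter_upwards [h1, h2] with x h1 h2
  exact Complex.nonneg_iff.2 ⟨h1, h2.symm⟩

lemma integrable_of_forall_setIntegral_le {X : Type*} [MeasurableSpace X]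
    {μ : Measure X} [SigmaFinite μ] {f : X → ℂ}
    (hf : ∀ A, MeasurableSet A → μ A < ∞ → IntegrableOn f A μ) (h0 : ∀ᵐ x ∂μ, 0 ≤ f x) {b : ℂ}
    (h : ∀ A, MeasurableSet A → μ A < ∞ → ∫ x in A, f x ∂μ ≤ b) :
    Integrable f μ ∧ ∫ x, f x ∂μ ≤ b := by
  have hc : AECover μ atTop (spanningSets μ) :=
    { ae_eventually_mem := .of_forall fun x => by
        filter_upwards [eventually_ge_atTop (spanningSetsIndex μ x)] with n hn
        exact mem_spanningSets_of_index_le μ x hn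
      measurableSet := measurableSet_spanningSets μ }
  have hfS : ∀ n, IntegrableOn f (spanningSets μ n) μ := fun n =>
    hf _ (measurableSet_spanningSets μ n) (measure_spanningSets_lt_top μ n)
  have hi : Integrable f μ := by
    refine hc.integrable_of_integral_norm_bounded b.re hfS (.of_forall fun n => ?_)
    have e : ∫ x in spanningSets μ n, ‖f x‖ ∂μ = ∫ x in spanningSets μ n, (f x).re ∂μ := by
      refine integral_congr_ae ((ae_restrict_of_ae h0).mono fun x hx => ?_)
      have h := Complex.nonneg_iff.1 hx
      change ‖f x‖ = (f x).re
      rw [← Complex.abs_re_eq_norm.2 h.2.symm, abs_of_nonneg h.1]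
    rw [e]
    refine (integral_re (hfS n)).trans_le ?_
    exact (Complex.le_def.1 (h _ (measurableSet_spanningSets μ n)
      (measure_spanningSets_lt_top μ n))).1
  refine ⟨hi, le_of_tendsto (hc.integral_tendsto_of_countably_generated hi)
    (.of_forall fun n => ?_)⟩
  exact h _ (measurableSet_spanningSets μ n) (measure_spanningSets_lt_top μ n)

lemma Lp.integrableOn_two {X : Type*} [MeasurableSpace X] {μ : Measure X} (f : Lp ℂ 2 μ)
    {A : Set X} (hμA : μ A < ∞) : IntegrableOn f A μ :=
  integrableOn_Lp_of_measure_ne_top f (by norm_num) hμA.ne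

/-- An operator is nonnegative and satisfies `Θ 1 ≤ 1` as soon as the bilinear form
`(A, B) ↦ ⟨1_B, Θ 1_A⟩` takes its values in `[0, ν(B)]`: for fixed `B`, this says that
`Θ* 1_B` is a nonnegative integrable function of integral at most `ν(B)`. -/
lemma isNonnegOperator_and_mapsOneLeOne {X Y : Type*} [MeasurableSpace X] [MeasurableSpace Y]
    {μ : Measure X} {ν : Measure Y} [SigmaFinite μ] [SigmaFinite ν]
    (Θ : Lp ℂ 2 μ →L[ℂ] Lp ℂ 2 ν)
    (h : ∀ (A : Set X) (hA : MeasurableSet A) (hμA : μ A ≠ ∞)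
      (B : Set Y) (hB : MeasurableSet B) (hνB : ν B ≠ ∞),
      0 ≤ inner ℂ (indicatorConstLp 2 hB hνB (1 : ℂ)) (Θ (indicatorConstLp 2 hA hμA (1 : ℂ))) ∧
      inner ℂ (indicatorConstLp 2 hB hνB (1 : ℂ)) (Θ (indicatorConstLp 2 hA hμA (1 : ℂ)))
        ≤ (ν.real B : ℂ)) :
    IsNonnegOperator Θ ∧ MapsOneLeOne Θ := by
  have key : ∀ (B : Set Y) (hB : MeasurableSet B) (hνB : ν B < ∞), ∃ k : Lp ℂ 2 μ,
      (∀ᵐ x ∂μ, 0 ≤ k x) ∧ Integrable k μ ∧ ∫ x, k x ∂μ ≤ ν.real B ∧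
      ∀ f : Lp ℂ 2 μ, Integrable (fun x => f x * k x) μ ∧
        ∫ y in B, Θ f y ∂ν = ∫ x, f x * k x ∂μ := by
    intro B hB hνB
    set k := ContinuousLinearMap.adjoint Θ (indicatorConstLp 2 hB hνB.ne (1 : ℂ)) with hk
    have hkA : ∀ A, MeasurableSet A → μ A < ∞ →
        0 ≤ ∫ x in A, k x ∂μ ∧ ∫ x in A, k x ∂μ ≤ ν.real B := by
      intro A hA hμA
      have h1 := h A hA hμA.ne B hB hνB.ne
      rw [← inner_indicatorConstLp_one_eq_setIntegral hA hμA.ne, hk,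
        ContinuousLinearMap.adjoint_inner_right, ← inner_conj_symm]
      refine ⟨star_nonneg_iff.2 h1.1, ?_⟩
      have h2 := star_le_star_iff.2 h1.2
      rwa [← starRingEnd_apply, ← starRingEnd_apply, Complex.conj_ofReal] at h2
    have hk0 : ∀ᵐ x ∂μ, 0 ≤ k x := ae_nonneg_of_forall_setIntegral_nonneg_complex
      (fun A _ hμA => Lp.integrableOn_two k hμA) fun A hA hμA => (hkA A hA hμA).1
    obtain ⟨hki, hkb⟩ := integrable_of_forall_setIntegral_le
      (fun A _ hμA => Lp.integrableOn_two k hμA) hk0 fun A hA hμA => (hkA A hA hμA).2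
    refine ⟨k, hk0, hki, hkb, fun f => ?_⟩
    have e : (fun x => inner ℂ (k x) (f x)) =ᵐ[μ] fun x => f x * k x := by
      filter_upwards [hk0] with x hx
      rw [RCLike.inner_apply, Complex.conj_eq_iff_im.2 (Complex.nonneg_iff.1 hx).2.symm]
    refine ⟨(L2.integrable_inner k f).congr e, ?_⟩
    rw [← inner_indicatorConstLp_one_eq_setIntegral hB hνB.ne,
      ← ContinuousLinearMap.adjoint_inner_left, ← hk, L2.inner_def, integral_congr_ae e]
  constructor
  · intro f hf
    refine ae_nonneg_of_forall_setIntegral_nonneg_complex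
      (fun B _ hνB => Lp.integrableOn_two _ hνB) fun B hB hνB => ?_
    obtain ⟨k, hk0, -, -, hkf⟩ := key B hB hνB
    rw [(hkf f).2]
    refine integral_nonneg_of_ae ?_
    filter_upwards [hf, hk0] with x h1 h2
    exact mul_nonneg h1 h2
  · intro f hf
    have hint : ∀ B, MeasurableSet B → ν B < ∞ → IntegrableOn (fun y => 1 - Θ f y) B ν :=
      fun B _ hνB => (integrableOn_const hνB.ne).sub (Lp.integrableOn_two _ hνB)
    have := ae_nonneg_of_forall_setIntegral_nonneg_complex hint fun B hB hνB => by
      obtain ⟨k, hk0, hki, hkb, hkf⟩ := key B hB hνB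
      have h1 : IntegrableOn (fun _ => (1 : ℂ)) B ν := integrableOn_const hνB.ne
      rw [integral_sub h1 (Lp.integrableOn_two _ hνB), (hkf f).2,
        sub_nonneg, setIntegral_const]
      refine (integral_mono_ae (hkf f).1 hki ?_).trans (hkb.trans (by simp))
      filter_upwards [hf, hk0] with x h1 h2
      exact mul_le_of_le_one_left h2 h1.2
    filter_upwards [this] with y hy
    exact sub_nonneg.1 hy

namespace IsPoissonMeasure

variable {X : Type*} [MeasurableSpace X] {μ : Measure X} {P : Measure (Measure X)}
  {A B : Set X}

/-! ### Nonnegative elements of `ℂ ⊕ 𝔠` -/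

lemma memLp_real_complex (hP : IsPoissonMeasure μ P) (hA : MeasurableSet A) (hμA : μ A ≠ ∞) :
    MemLp (fun ξ : Measure X => (ξ.real A : ℂ)) 2 P :=
  (hP.memLp_real hA hμA).ofReal

lemma memLp_rpow_complex (hP : IsPoissonMeasure μ P) (hA : MeasurableSet A) (hμA : μ A ≠ ∞)
    {x : ℝ} (hx : 0 ≤ x) : MemLp (fun ξ : Measure X => ((x ^ ξ.real A : ℝ) : ℂ)) 2 P :=
  (hP.memLp_rpow hA hμA hx).ofReal

variable [IsProbabilityMeasure P]

/-- The exponential tilt of `integral_centered_mul_rpow`, for an arbitrary centered integral. -/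
lemma inner_rpow_centeredIntegral (hP : IsPoissonMeasure μ P) (hA : MeasurableSet A)
    (hμA : μ A ≠ ∞) {x : ℝ} (hx : 0 ≤ x) (g : Lp ℂ 2 μ) :
    inner ℂ ((hP.memLp_rpow_complex hA hμA hx).toLp _) (hP.centeredIntegral g)
      = (((x - 1) * Real.exp ((x - 1) * μ.real A) : ℝ) : ℂ) * ∫ y in A, g y ∂μ := by
  set c : ℂ := (((x - 1) * Real.exp ((x - 1) * μ.real A) : ℝ) : ℂ) with hc
  set Z := (hP.memLp_rpow_complex hA hμA hx).toLp _
  have hext : (innerSL ℂ Z).comp hP.centeredIntegral.toContinuousLinearMap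
      = c • innerSL ℂ (indicatorConstLp 2 hA hμA (1 : ℂ)) := by
    refine ContinuousLinearMap.ext_on (dense_span_indicatorConstLp μ) ?_
    rintro _ ⟨⟨B, hB, hμB⟩, rfl⟩
    have h1 := hP.integral_centered_mul_rpow hA hμA hB hμB hx
    simp only [ContinuousLinearMap.comp_apply, LinearIsometry.coe_toContinuousLinearMap,
      innerSL_apply_apply, smul_apply, smul_eq_mul]
    rw [hP.centeredIntegral_indicatorConstLp hB hμB,
      L2.inner_indicatorConstLp_one_indicatorConstLp_one hA hB, hc, L2.inner_def]
    have h2 : ∫ ξ, ((x ^ ξ.real A * (ξ.real B - μ.real B) : ℝ) : ℂ) ∂P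
        = (((x - 1) * Real.exp ((x - 1) * μ.real A) * μ.real (A ∩ B) : ℝ) : ℂ) := by
      rw [integral_complex_ofReal, h1]
    refine Eq.trans (integral_congr_ae ?_) (h2.trans (by push_cast; rfl))
    filter_upwards [(hP.memLp_rpow_complex hA hμA hx).coeFn_toLp,
      (hP.memLp_centered_real hB hμB).coeFn_toLp] with ξ h3 h4
    rw [h3, h4, RCLike.inner_apply, Complex.conj_ofReal]
    push_cast
    ring
  have := DFunLike.congr_fun hext g
  simpa [inner_indicatorConstLp_one_eq_setIntegral] using this

lemma nonneg_of_ae_nonneg_centeredIntegral_add (hP : IsPoissonMeasure μ P) {g : Lp ℂ 2 μ} {b : ℂ}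
    (h : ∀ᵐ ξ ∂P, 0 ≤ hP.centeredIntegral g ξ + b) (hA : MeasurableSet A) (hμA : μ A ≠ ∞)
    {x : ℝ} (hx : 0 ≤ x) : 0 ≤ ((x - 1 : ℝ) : ℂ) * ∫ y in A, g y ∂μ + b := by
  have hZ := hP.memLp_rpow_complex hA hμA hx
  have h1 := hP.inner_rpow_centeredIntegral hA hμA hx g
  have i1 := L2.integrable_inner (𝕜 := ℂ) (hZ.toLp _) (hP.centeredIntegral g)
  have i2 : Integrable (fun ξ : Measure X => ((x ^ ξ.real A : ℝ) : ℂ) * b) P :=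
    (hZ.integrable (by norm_num)).mul_const b
  have h2 : ∫ ξ, ((x ^ ξ.real A : ℝ) : ℂ) * b ∂P = (Real.exp ((x - 1) * μ.real A) : ℂ) * b := by
    rw [integral_mul_const, integral_complex_ofReal, hP.integral_rpow hA hμA hx]
  have h3 : 0 ≤ ∫ ξ, (inner ℂ (hZ.toLp _ ξ) (hP.centeredIntegral g ξ)
      + ((x ^ ξ.real A : ℝ) : ℂ) * b) ∂P := by
    refine integral_nonneg_of_ae ?_
    filter_upwards [h, hZ.coeFn_toLp] with ξ h3 h4
    rw [h4, RCLike.inner_apply, Complex.conj_ofReal, mul_comm, ← mul_add]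
    exact mul_nonneg (Complex.zero_le_real.2 (Real.rpow_nonneg hx _)) h3
  rw [integral_add i1 i2, h2, ← L2.inner_def, h1] at h3
  have h4 : (0 : ℂ) ≤ ((Real.exp ((x - 1) * μ.real A))⁻¹ : ℝ) :=
    Complex.zero_le_real.2 (inv_nonneg.2 (Real.exp_nonneg _))
  have h5 := mul_nonneg h4 h3
  have h6 : (Real.exp ((x - 1) * μ.real A) : ℂ) ≠ 0 :=
    Complex.ofReal_ne_zero.2 (Real.exp_ne_zero _)
  convert h5 using 1
  rw [Complex.ofReal_mul, Complex.ofReal_inv]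
  field_simp

/-- If `M(g) + b ≥ 0`, then `g` is nonnegative and integrable, and `∫ g dμ ≤ b`. Testing
`M(g) + b` against `x ^ N(A)` gives `(x - 1) ∫_A g dμ + b ≥ 0` for all `x ≥ 0`: for large `x` this
yields `∫_A g dμ ≥ 0`, and `x = 0` yields `∫_A g dμ ≤ b`. -/
lemma nonneg_and_integrable_of_ae_nonneg [SigmaFinite μ] (hP : IsPoissonMeasure μ P)
    {g : Lp ℂ 2 μ} {b : ℂ} (h : ∀ᵐ ξ ∂P, 0 ≤ hP.centeredIntegral g ξ + b) :
    (∀ᵐ x ∂μ, 0 ≤ g x) ∧ Integrable g μ ∧ ∫ x, g x ∂μ ≤ b := by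
  have hb : 0 ≤ b := by
    simpa using hP.nonneg_of_ae_nonneg_centeredIntegral_add h MeasurableSet.empty (by simp)
      zero_le_one
  have h0 : ∀ᵐ x ∂μ, 0 ≤ g x := by
    refine ae_nonneg_of_forall_setIntegral_nonneg_complex
      (fun A _ hμA => Lp.integrableOn_two g hμA) fun A hA hμA => ?_
    set I := ∫ x in A, g x ∂μ
    have hn : ∀ n : ℕ, 0 ≤ (n : ℝ) * I.re + b.re ∧ 0 = (n : ℝ) * I.im + b.im := fun n => by
      have := hP.nonneg_of_ae_nonneg_centeredIntegral_add h hA hμA.ne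
        (x := n + 1) (by positivity)
      rw [add_sub_cancel_right, Complex.nonneg_iff] at this
      simpa only [Complex.add_re, Complex.add_im, Complex.re_ofReal_mul,
        Complex.im_ofReal_mul] using this
    refine Complex.nonneg_iff.2 ⟨?_, ?_⟩
    · by_contra! hI
      obtain ⟨n, hlt⟩ := exists_nat_gt (b.re / -I.re)
      rw [div_lt_iff₀ (by linarith)] at hlt
      linarith [(hn n).1]
    · have h1 := (hn 1).2
      have h2 := (hn 0).2
      push_cast at h1 h2
      linarith
  refine ⟨h0, integrable_of_forall_setIntegral_le (fun A _ hμA => Lp.integrableOn_two g hμA) h0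
    fun A hA hμA => ?_⟩
  have := hP.nonneg_of_ae_nonneg_centeredIntegral_add h hA hμA.ne le_rfl
  rw [zero_sub, Complex.ofReal_neg, Complex.ofReal_one, neg_one_mul, neg_add_eq_sub,
    sub_nonneg] at this
  exact this

end IsPoissonMeasure

/-! ### Markov operators -/

lemma eq_zero_of_forall_exp_mul_le {α β r : ℝ} (hα : 0 ≤ α) (hβ : 0 ≤ β) (hr : 1 < r)
    (h : ∀ s, 0 ≤ s → (Real.exp (s * r) - 1) * β ≤ (Real.exp s - 1) * α) : β = 0 := by
  by_contra hne
  have hβ' : 0 < β := lt_of_le_of_ne hβ (Ne.symm hne)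
  have hr' : 0 < r - 1 := by linarith
  -- For this `s`, `β * exp (s * (r - 1)) ≥ β * (1 + s * (r - 1)) = β + α + 1`.
  set s := (α + 1) / (β * (r - 1)) with hs
  have hs0 : 0 ≤ s := by positivity
  have h1 := h s hs0
  have h2 : Real.exp (s * r) = Real.exp s * Real.exp (s * (r - 1)) := by
    rw [← Real.exp_add]
    congr 1
    ring
  have h3 : β + α + 1 ≤ Real.exp (s * (r - 1)) * β := by
    have h4 := mul_le_mul_of_nonneg_right (Real.add_one_le_exp (s * (r - 1))) hβ
    have h5 : s * (r - 1) * β = α + 1 := by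
      rw [hs]
      field_simp
    nlinarith
  have h6 := mul_le_mul_of_nonneg_left h3 (Real.exp_nonneg s)
  have h7 := Real.one_le_exp hs0
  rw [h2] at h1
  nlinarith

lemma inner_const_one {X : Type*} [MeasurableSpace X] {P : Measure X}
    [IsProbabilityMeasure P] (F : Lp ℂ 2 P) : inner ℂ (Lp.const 2 P (1 : ℂ)) F = ∫ x, F x ∂P := by
  rw [← indicatorConstLp_univ, inner_indicatorConstLp_one_eq_setIntegral, setIntegral_univ]

namespace IsMarkovOperator

variable {X Y : Type*} [MeasurableSpace X] [MeasurableSpace Y] {P : Measure X} {Q : Measure Y}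
  [IsProbabilityMeasure P] [IsProbabilityMeasure Q] {Ψ : Lp ℂ 2 P →L[ℂ] Lp ℂ 2 Q}

lemma integral_apply (hΨ : IsMarkovOperator Ψ) (F : Lp ℂ 2 P) :
    ∫ y, Ψ F y ∂Q = ∫ x, F x ∂P := by
  rw [← inner_const_one, ← ContinuousLinearMap.adjoint_inner_left, hΨ.adjoint_map_one,
    inner_const_one]

/-- Jensen's inequality `Ψ (exp (s u)) ≥ exp (s Ψ u)`, in the form of the tangent to the
exponential at a point `t`. -/
lemma exp_mul_le_apply_exp (hΨ : IsMarkovOperator Ψ) {u : X → ℝ} {s : ℝ}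
    (hu : MemLp (fun x => (u x : ℂ)) 2 P)
    (he : MemLp (fun x => (Real.exp (s * u x) : ℂ)) 2 P) (t : ℝ) :
    ∀ᵐ y ∂Q, Real.exp (s * t) * (1 + s * ((Ψ (hu.toLp _) y).re - t))
      ≤ (Ψ (he.toLp _) y).re := by
  set c : ℂ := (Real.exp (s * t) : ℂ)
  have h1 : ∀ᵐ x ∂P, 0 ≤ (he.toLp _ - (c * s) • hu.toLp _
      - (c * (1 - s * t)) • Lp.const 2 P (1 : ℂ) : Lp ℂ 2 P) x := by
    filter_upwards [Lp.coeFn_sub (he.toLp _ - (c * s) • hu.toLp _)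
      ((c * (1 - s * t)) • Lp.const 2 P (1 : ℂ)), Lp.coeFn_sub (he.toLp _) ((c * s) • hu.toLp _),
      Lp.coeFn_smul (c * s) (hu.toLp _), Lp.coeFn_smul (c * (1 - s * t)) (Lp.const 2 P (1 : ℂ)),
      he.coeFn_toLp, hu.coeFn_toLp, Lp.coeFn_const (p := 2) (μ := P) (1 : ℂ)]
      with x e1 e2 e3 e4 e5 e6 e7
    rw [e1, Pi.sub_apply, e2, Pi.sub_apply, e3, e4, Pi.smul_apply, Pi.smul_apply, e5, e6, e7]
    have h2 : 0 ≤ Real.exp (s * u x) - Real.exp (s * t) * s * u x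
        - Real.exp (s * t) * (1 - s * t) := by
      have h3 := mul_le_mul_of_nonneg_left (Real.add_one_le_exp (s * u x - s * t))
        (Real.exp_nonneg (s * t))
      rw [← Real.exp_add, add_sub_cancel] at h3
      linarith
    have h4 := Complex.zero_le_real.2 h2
    convert h4 using 1
    simp [c]
  have h2 := hΨ.nonneg _ h1
  rw [map_sub, map_sub, map_smul, map_smul, hΨ.map_one] at h2
  filter_upwards [h2, Lp.coeFn_sub (Ψ (he.toLp _) - (c * s) • Ψ (hu.toLp _))
      ((c * (1 - s * t)) • Lp.const 2 Q (1 : ℂ)),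
      Lp.coeFn_sub (Ψ (he.toLp _)) ((c * s) • Ψ (hu.toLp _)),
      Lp.coeFn_smul (c * s) (Ψ (hu.toLp _)),
      Lp.coeFn_smul (c * (1 - s * t)) (Lp.const 2 Q (1 : ℂ)),
      Lp.coeFn_const (p := 2) (μ := Q) (1 : ℂ)] with y h3 e1 e2 e3 e4 e5
  rw [e1, Pi.sub_apply, e2, Pi.sub_apply, e3, e4, Pi.smul_apply, Pi.smul_apply, e5] at h3
  have h4 := (Complex.nonneg_iff.1 h3).1
  have h5 : c * s = ((Real.exp (s * t) * s : ℝ) : ℂ) := by simp [c]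
  have h6 : c * (1 - s * t) = ((Real.exp (s * t) * (1 - s * t) : ℝ) : ℂ) := by simp [c]
  rw [h5, h6] at h4
  simp only [smul_eq_mul, Complex.sub_re, Complex.re_ofReal_mul, Function.const_apply,
    Complex.one_re] at h4
  linarith

end IsMarkovOperator

/-! ### The operator induced on the first chaos -/

namespace IsPoissonMeasure

variable {X Y : Type*} [MeasurableSpace X] [MeasurableSpace Y] {μ : Measure X} {ν : Measure Y}
  {P : Measure (Measure X)} {Q : Measure (Measure Y)}
  [IsProbabilityMeasure P] [IsProbabilityMeasure Q] {Ψ : Lp ℂ 2 P →L[ℂ] Lp ℂ 2 Q}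
  {Θ : Lp ℂ 2 μ →L[ℂ] Lp ℂ 2 ν} {A : Set X} {B : Set Y}

/-- A Markov operator cannot map `N(A)` above `r N(B)` with `r > 1`, unless `B` is a null set:
by Jensen's inequality the exponential moments of `r N(B)` would be at most those of `N(A)`. -/
lemma measureReal_eq_zero_of_le_apply (hP : IsPoissonMeasure μ P) (hQ : IsPoissonMeasure ν Q)
    (hΨ : IsMarkovOperator Ψ) (hA : MeasurableSet A) (hμA : μ A ≠ ∞) (hB : MeasurableSet B)
    (hνB : ν B ≠ ∞) {r : ℝ} (hr : 1 < r)
    (hN : MemLp (fun ξ : Measure X => (ξ.real A : ℂ)) 2 P)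
    (h : ∀ᵐ η ∂Q, r * η.real B ≤ (Ψ (hN.toLp _) η).re) : ν.real B = 0 := by
  refine eq_zero_of_forall_exp_mul_le (α := μ.real A) measureReal_nonneg measureReal_nonneg hr
    fun s hs => ?_
  have e1 : ∀ ξ : Measure X, (Real.exp s) ^ ξ.real A = Real.exp (s * ξ.real A) := fun ξ =>
    (Real.exp_mul _ _).symm
  have e2 : ∀ η : Measure Y, (Real.exp (s * r)) ^ η.real B = Real.exp (s * (r * η.real B)) :=
    fun η => by rw [← Real.exp_mul, mul_assoc]
  have he : MemLp (fun ξ : Measure X => (Real.exp (s * ξ.real A) : ℂ)) 2 P := by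
    simpa only [e1] using hP.memLp_rpow_complex hA hμA (Real.exp_nonneg s)
  have htan : ∀ᵐ η ∂Q, ∀ k : ℕ,
      Real.exp (s * (r * k)) * (1 + s * ((Ψ (hN.toLp _) η).re - r * k))
        ≤ (Ψ (he.toLp _) η).re :=
    ae_all_iff.2 fun k => hΨ.exp_mul_le_apply_exp hN he (r * k)
  have hle : ∀ᵐ η ∂Q, (Real.exp (s * r)) ^ η.real B ≤ (Ψ (he.toLp _) η).re := by
    filter_upwards [htan, h, hQ.ae_eval_eq_natCast hB hνB] with η h1 h2 ⟨k, hk⟩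
    have hk' : η.real B = k := by simp [measureReal_def, hk]
    rw [e2, hk']
    rw [hk'] at h2
    refine le_trans ?_ (h1 k)
    refine le_mul_of_one_le_right (Real.exp_nonneg _) ?_
    linarith [mul_nonneg hs (sub_nonneg.2 h2)]
  have hint : Integrable (Ψ (he.toLp _)) Q := (Lp.memLp _).integrable (by norm_num)
  have h1 := integral_mono_ae (hQ.integrable_rpow hB hνB (Real.exp_nonneg (s * r))) hint.re hle
  have h2 : ∫ η, RCLike.re (Ψ (he.toLp _) η) ∂Q = ∫ ξ, Real.exp s ^ ξ.real A ∂P := by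
    rw [integral_re hint, hΨ.integral_apply, integral_congr_ae he.coeFn_toLp,
      integral_complex_ofReal]
    simp only [e1]
    exact Complex.ofReal_re _
  rw [h2, hQ.integral_rpow hB hνB (Real.exp_nonneg _),
    hP.integral_rpow hA hμA (Real.exp_nonneg _)] at h1
  exact Real.exp_le_exp.1 h1

/-- If `Ψ` induces `Θ`, then `Ψ (N(A)) = M(Θ 1_A) + μ(A)`, because `N(A) = M(1_A) + μ(A)`. -/
lemma apply_count (hP : IsPoissonMeasure μ P) (hQ : IsPoissonMeasure ν Q)
    (hΨ : IsMarkovOperator Ψ)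
    (hΘ : ∀ g, hQ.centeredIntegral (Θ g) = Ψ (hP.centeredIntegral g))
    (hA : MeasurableSet A) (hμA : μ A ≠ ∞) :
    ∀ᵐ η ∂Q, Ψ ((hP.memLp_real_complex hA hμA).toLp _) η
      = hQ.centeredIntegral (Θ (indicatorConstLp 2 hA hμA 1)) η + μ.real A := by
  have e : (hP.memLp_real_complex hA hμA).toLp _
      = hP.centeredIntegral (indicatorConstLp 2 hA hμA 1)
        + (μ.real A : ℂ) • Lp.const 2 P (1 : ℂ) := by
    refine Lp.ext ?_
    rw [hP.centeredIntegral_indicatorConstLp hA hμA]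
    filter_upwards [(hP.memLp_real_complex hA hμA).coeFn_toLp,
      Lp.coeFn_add ((hP.memLp_centered_real hA hμA).toLp _)
        ((μ.real A : ℂ) • Lp.const 2 P (1 : ℂ)), (hP.memLp_centered_real hA hμA).coeFn_toLp,
      Lp.coeFn_smul (μ.real A : ℂ) (Lp.const 2 P (1 : ℂ)),
      Lp.coeFn_const (p := 2) (μ := P) (1 : ℂ)] with ξ e1 e2 e3 e4 e5
    rw [e1, e2, Pi.add_apply, e3, e4, Pi.smul_apply, e5]
    simp
  rw [e, map_add, map_smul, hΨ.map_one, ← hΘ]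
  filter_upwards [Lp.coeFn_add (hQ.centeredIntegral (Θ (indicatorConstLp 2 hA hμA 1)))
      ((μ.real A : ℂ) • Lp.const 2 Q (1 : ℂ)),
      Lp.coeFn_smul (μ.real A : ℂ) (Lp.const 2 Q (1 : ℂ)),
      Lp.coeFn_const (p := 2) (μ := Q) (1 : ℂ)] with η e1 e2 e3
  rw [e1, Pi.add_apply, e2, Pi.smul_apply, e3]
  simp

variable [SigmaFinite ν]

/-- `Θ 1_A` is nonnegative, with integral at most `μ(A)`, since `M(Θ 1_A) + μ(A) = Ψ (N(A)) ≥ 0`. -/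
lemma nonneg_and_integrable_apply_indicator (hP : IsPoissonMeasure μ P)
    (hQ : IsPoissonMeasure ν Q) (hΨ : IsMarkovOperator Ψ)
    (hΘ : ∀ g, hQ.centeredIntegral (Θ g) = Ψ (hP.centeredIntegral g))
    (hA : MeasurableSet A) (hμA : μ A ≠ ∞) :
    (∀ᵐ y ∂ν, 0 ≤ Θ (indicatorConstLp 2 hA hμA 1) y) ∧
      Integrable (Θ (indicatorConstLp 2 hA hμA 1)) ν ∧
      ∫ y, Θ (indicatorConstLp 2 hA hμA 1) y ∂ν ≤ μ.real A := by
  refine hQ.nonneg_and_integrable_of_ae_nonneg ?_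
  have h0 := hΨ.nonneg ((hP.memLp_real_complex hA hμA).toLp _) (by
    filter_upwards [(hP.memLp_real_complex hA hμA).coeFn_toLp] with ξ e
    rw [e]
    exact Complex.zero_le_real.2 measureReal_nonneg)
  filter_upwards [h0, hP.apply_count hQ hΨ hΘ hA hμA] with η h1 h2
  rwa [← h2]

/-- On a set `B` where `Θ 1_A ≥ r`, the inequality `Ψ (N(A)) ≥ r N(B)` holds. -/
lemma measureReal_eq_zero_of_le_apply_indicator (hP : IsPoissonMeasure μ P)
    (hQ : IsPoissonMeasure ν Q) (hΨ : IsMarkovOperator Ψ)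
    (hΘ : ∀ g, hQ.centeredIntegral (Θ g) = Ψ (hP.centeredIntegral g))
    (hA : MeasurableSet A) (hμA : μ A ≠ ∞) (hB : MeasurableSet B) (hνB : ν B ≠ ∞) {r : ℝ}
    (hr : 1 < r) (h : ∀ y ∈ B, r ≤ (Θ (indicatorConstLp 2 hA hμA 1) y).re) : ν.real B = 0 := by
  refine hP.measureReal_eq_zero_of_le_apply hQ hΨ hA hμA hB hνB hr
    (hP.memLp_real_complex hA hμA) ?_
  obtain ⟨h0, hi, hle⟩ := hP.nonneg_and_integrable_apply_indicator hQ hΨ hΘ hA hμA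
  set k := Θ (indicatorConstLp 2 hA hμA 1)
  filter_upwards [hP.apply_count hQ hΨ hΘ hA hμA, hQ.centeredIntegral_of_integrable k hi,
    hQ.ae_integrable hi, hQ.ae_ae h0, hQ.ae_eval_eq_natCast hB hνB] with η h1 h2 h3 h4 ⟨n, hn⟩
  rw [h1, h2, Complex.add_re, Complex.sub_re, Complex.ofReal_re]
  have h5 : r * η.real B ≤ (∫ y, k y ∂η).re := by
    have hηB : η B ≠ ∞ := by simp [hn]
    have h6 : ∫ y, B.indicator (fun _ => r) y ∂η ≤ ∫ y, RCLike.re (k y) ∂η := by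
      refine integral_mono_ae ((integrable_indicator_iff hB).2 (integrableOn_const hηB)) h3.re ?_
      filter_upwards [h4] with y hy
      by_cases hyB : y ∈ B
      · rw [Set.indicator_of_mem hyB]
        exact h y hyB
      · rw [Set.indicator_of_notMem hyB]
        exact (Complex.nonneg_iff.1 hy).1
    rw [integral_re h3, integral_indicator_const r hB, smul_eq_mul, mul_comm] at h6
    exact h6
  have h7 := (Complex.le_def.1 hle).1
  rw [Complex.ofReal_re] at h7
  linarith

/-- The set where `Θ 1_A > 1` is a countable union of sets of finite measure on which `Θ 1_A` is
bounded below by a constant `r > 1`, and these are null. -/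
lemma ae_apply_indicator_le_one (hP : IsPoissonMeasure μ P)
    (hQ : IsPoissonMeasure ν Q) (hΨ : IsMarkovOperator Ψ)
    (hΘ : ∀ g, hQ.centeredIntegral (Θ g) = Ψ (hP.centeredIntegral g))
    (hA : MeasurableSet A) (hμA : μ A ≠ ∞) :
    ∀ᵐ y ∂ν, Θ (indicatorConstLp 2 hA hμA 1) y ≤ 1 := by
  obtain ⟨h0, -, -⟩ := hP.nonneg_and_integrable_apply_indicator hQ hΨ hΘ hA hμA
  set k := Θ (indicatorConstLp 2 hA hμA 1)
  have hkm : Measurable fun y => (k y).re :=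
    Complex.measurable_re.comp (Lp.stronglyMeasurable k).measurable
  have hnull : ∀ᵐ y ∂ν, ∀ n m : ℕ,
      y ∉ {y | 1 + 1 / ((n : ℝ) + 1) ≤ (k y).re} ∩ spanningSets ν m := by
    refine ae_all_iff.2 fun n => ae_all_iff.2 fun m => ?_
    have hfin := measure_ne_top_of_subset (μ := ν)
      (Set.inter_subset_right (s := {y | 1 + 1 / ((n : ℝ) + 1) ≤ (k y).re}))
      (measure_spanningSets_lt_top ν m).ne
    have := hP.measureReal_eq_zero_of_le_apply_indicator hQ hΨ hΘ hA hμA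
      ((measurableSet_le measurable_const hkm).inter (measurableSet_spanningSets ν m)) hfin
      (r := 1 + 1 / ((n : ℝ) + 1)) (lt_add_of_pos_right _ (by positivity)) fun y hy => hy.1
    exact measure_eq_zero_iff_ae_notMem.1 ((measureReal_eq_zero_iff hfin).1 this)
  filter_upwards [h0, hnull] with y hy0 hy
  refine Complex.le_def.2 ⟨?_, (Complex.nonneg_iff.1 hy0).2.symm⟩
  rw [Complex.one_re]
  by_contra! hlt
  obtain ⟨n, hn⟩ := exists_nat_one_div_lt (sub_pos.2 hlt)
  refine hy n (spanningSetsIndex ν y) ⟨?_, mem_spanningSetsIndex ν y⟩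
  change 1 + 1 / ((n : ℝ) + 1) ≤ (k y).re
  linarith

lemma isSubMarkovOperator [SigmaFinite μ] (hP : IsPoissonMeasure μ P)
    (hQ : IsPoissonMeasure ν Q) (hΨ : IsMarkovOperator Ψ)
    (hΘ : ∀ g, hQ.centeredIntegral (Θ g) = Ψ (hP.centeredIntegral g)) :
    IsSubMarkovOperator Θ := by
  have key : ∀ (A : Set X) (hA : MeasurableSet A) (hμA : μ A ≠ ∞)
      (B : Set Y) (hB : MeasurableSet B) (hνB : ν B ≠ ∞), ∃ q : ℝ,
      inner ℂ (indicatorConstLp 2 hB hνB (1 : ℂ)) (Θ (indicatorConstLp 2 hA hμA (1 : ℂ))) = q ∧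
      0 ≤ q ∧ q ≤ ν.real B ∧ q ≤ μ.real A := by
    intro A hA hμA B hB hνB
    obtain ⟨h0, hi, hle⟩ := hP.nonneg_and_integrable_apply_indicator hQ hΨ hΘ hA hμA
    have h1 := hP.ae_apply_indicator_le_one hQ hΨ hΘ hA hμA
    rw [inner_indicatorConstLp_one_eq_setIntegral hB hνB]
    set k := Θ (indicatorConstLp 2 hA hμA 1)
    have hc : IntegrableOn (fun _ : Y => (1 : ℂ)) B ν := integrableOn_const hνB
    have i0 : 0 ≤ ∫ y in B, k y ∂ν := integral_nonneg_of_ae (ae_restrict_of_ae h0)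
    have i1 : ∫ y in B, k y ∂ν ≤ ∫ y in B, (1 : ℂ) ∂ν :=
      integral_mono_ae hi.integrableOn hc (ae_restrict_of_ae h1)
    have i2 : ∫ y in B, k y ∂ν ≤ ∫ y, k y ∂ν := by
      rw [← integral_indicator hB]
      refine integral_mono_ae (hi.indicator hB) hi ?_
      filter_upwards [h0] with y hy
      exact Set.indicator_apply_le' (fun _ => le_rfl) fun _ => hy
    have hre : ∫ y in B, k y ∂ν = ((∫ y in B, k y ∂ν).re : ℂ) :=
      Complex.eq_re_of_ofReal_le (r := 0) (by simpa using i0)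
    have i3 := i2.trans hle
    rw [setIntegral_const] at i1
    rw [hre] at i0 i1 i3
    refine ⟨_, hre, Complex.zero_le_real.1 i0, ?_, Complex.real_le_real.1 i3⟩
    exact Complex.real_le_real.1 (i1.trans (by simp))
  have hΘ' := isNonnegOperator_and_mapsOneLeOne Θ fun A hA hμA B hB hνB => by
    obtain ⟨q, hq, h0, h1, -⟩ := key A hA hμA B hB hνB
    rw [hq]
    exact ⟨Complex.zero_le_real.2 h0, Complex.real_le_real.2 h1⟩
  refine ⟨hΘ'.1, hΘ'.2, (isNonnegOperator_and_mapsOneLeOne _ fun B hB hνB A hA hμA => ?_).2⟩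
  obtain ⟨q, hq, h0, -, h1⟩ := key A hA hμA B hB hνB
  rw [ContinuousLinearMap.adjoint_inner_right, ← inner_conj_symm, hq, Complex.conj_ofReal]
  exact ⟨Complex.zero_le_real.2 h0, Complex.real_le_real.2 h1⟩

end IsPoissonMeasure

theorem mainTheorem5 {X Y : Type*} [MeasurableSpace X] [MeasurableSpace Y]
    (μ : Measure X) (ν : Measure Y) [SigmaFinite μ] [SigmaFinite ν]
    (P : Measure (Measure X)) (Q : Measure (Measure Y))
    [IsProbabilityMeasure P] [IsProbabilityMeasure Q]
    (hP : IsPoissonMeasure μ P) (hQ : IsPoissonMeasure ν Q) :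
    (∀ Ψ : Lp ℂ 2 P →L[ℂ] Lp ℂ 2 Q, IsMarkovOperator Ψ →
      (∀ F ∈ firstChaos μ P, Ψ F ∈ firstChaos ν Q) →
      ∃ Θ : Lp ℂ 2 μ →L[ℂ] Lp ℂ 2 ν,
        InducesOnFirstChaos μ ν Ψ Θ ∧
        (∀ Θ' : Lp ℂ 2 μ →L[ℂ] Lp ℂ 2 ν, InducesOnFirstChaos μ ν Ψ Θ' → Θ' = Θ) ∧
        IsSubMarkovOperator Θ) ∧
    (∀ F ∈ firstChaos ν Q, ∀ b : ℂ, (∀ᵐ η ∂Q, 0 ≤ F η + b) →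
      ∃ (f : Y → ℝ) (c : ℝ), MemLp f 1 ν ∧ MemLp f 2 ν ∧ (∀ᵐ y ∂ν, 0 ≤ f y) ∧ 0 ≤ c ∧
        ∀ᵐ η ∂Q, Integrable f η ∧ F η + b = (((∫ y, f y ∂η) + c : ℝ) : ℂ)) := by
  constructor
  · intro Ψ hΨ hC
    set TP := hP.centeredIntegral.toContinuousLinearMap
    set TQ := hQ.centeredIntegral.toContinuousLinearMap
    have hinduces : ∀ Θ : Lp ℂ 2 μ →L[ℂ] Lp ℂ 2 ν, InducesOnFirstChaos μ ν Ψ Θ ↔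
        ∀ g, hQ.centeredIntegral (Θ g) = Ψ (hP.centeredIntegral g) := fun Θ => by
      simp only [InducesOnFirstChaos, hP.isCenteredIntegral_iff, hQ.isCenteredIntegral_iff,
        exists_eq_left, eq_comm]
    have hTT : (ContinuousLinearMap.adjoint TQ).comp TQ = 1 :=
      (ContinuousLinearMap.norm_map_iff_adjoint_comp_self TQ).1 hQ.centeredIntegral.norm_map
    -- Since `TQ` is an isometry, its adjoint inverts it on its range, the first chaos.
    have hΘ : ∀ g, hQ.centeredIntegral (((ContinuousLinearMap.adjoint TQ).comp (Ψ.comp TP)) g)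
        = Ψ (hP.centeredIntegral g) := fun g => by
      obtain ⟨k, hk⟩ := (hQ.mem_firstChaos_iff _).1
        (hC _ ((hP.mem_firstChaos_iff _).2 ⟨g, rfl⟩))
      have e : ContinuousLinearMap.adjoint TQ (Ψ (TP g)) = k := by
        have h1 : Ψ (TP g) = TQ k := hk
        rw [h1]
        exact DFunLike.congr_fun hTT k
      rw [ContinuousLinearMap.comp_apply, ContinuousLinearMap.comp_apply, e, hk]
    refine ⟨_, (hinduces _).2 hΘ, fun Θ' hΘ' => ?_, hP.isSubMarkovOperator hQ hΨ hΘ⟩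
    ext1 g
    exact hQ.centeredIntegral.injective (((hinduces Θ').1 hΘ' g).trans (hΘ g).symm)
  · intro F hF b hb
    obtain ⟨g, rfl⟩ := (hQ.mem_firstChaos_iff F).1 hF
    obtain ⟨h0, hi, hle⟩ := hQ.nonneg_and_integrable_of_ae_nonneg hb
    refine ⟨fun y => (g y).re, (b - ∫ y, g y ∂ν).re, memLp_one_iff_integrable.2 hi.re,
      (Lp.memLp g).re, h0.mono fun y hy => (Complex.nonneg_iff.1 hy).1,
      (Complex.nonneg_iff.1 (sub_nonneg.2 hle)).1, ?_⟩
    filter_upwards [hQ.centeredIntegral_of_integrable g hi, hQ.ae_integrable hi, hQ.ae_ae h0]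
      with η h1 h2 h3
    refine ⟨h2.re, ?_⟩
    have h4 : ∫ y, g y ∂η = ((∫ y, (g y).re ∂η : ℝ) : ℂ) := by
      rw [← integral_complex_ofReal]
      refine integral_congr_ae (h3.mono fun y hy => ?_)
      exact Complex.eq_re_of_ofReal_le (r := 0) (by simpa using hy)
    have h5 : b - ∫ y, g y ∂ν = ((b - ∫ y, g y ∂ν).re : ℂ) :=
      Complex.eq_re_of_ofReal_le (r := 0) (by simpa using sub_nonneg.2 hle)
    rw [h1, Complex.ofReal_add, ← h4, ← h5]
    ring
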